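/- Let $E$ be a finite set, let $\mathcal X$ be a Polish space with its Borel $\sigma$-algebra, write $\mathbb N=\{0,1,2,\dots\}$, $\mathbb N^*=\{1,2,\dots\}$, and equip $E^{\mathbb N}$, $E^{\mathbb N^*}$ with their product $\sigma$-algebras. For probability measures $\nu_1,\nu_2$ on $E$ let $d_{TV}(\nu_1,\nu_2)=\frac12\sum_{e\in E}|\nu_1(e)-\nu_2(e)|$. For every $x\in\mathcal X$ let $(q_t^x)_{t\in\mathbb Z}$ and $(\bar q_t^x)_{t\in\mathbb Z}$ be two sequences of probability kernels from $E^{\mathbb N}$ to $E$. Assume: (A1) for every $t\in\mathbb Z$ the maps $(y,z,x)\mapsto q_t^x(y\mid z)$ and $(y,z,x)\mapsto\bar q_t^x(y\mid z)$ on $E\times E^{\mathbb N}\times\mathcal X$ are measurable and take positive values; (A2) the numbers $$b_m=\sup\bigl\{d_{TV}\bigl(q_t^x(\cdot\mid y),q_t^x(\cdot\mid y')\bigr):\ t\in\mathbb Z,\ x\in\mathcal X,\ y,y'\in E^{\mathbb N},\ y_i=y'_i\text{ for }0\le i\le m-1\bigr\},\qquad m\in\mathbb N,$$ satisfy $b_0<1$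 and $\lim_{m\to\infty}b_m=0$. Fix $t_0\in\mathbb Z$. For $x\in\mathcal X$ and $z\in E^{\mathbb N}$ let $Q_{t_0,x,z}$ be the probability measure on $E^{\mathbb N^*}$ determined by $$Q_{t_0,x,z}\bigl(\{w: w_1=y_1,\dots,w_n=y_n\}\bigr)=\prod_{i=1}^n q_{t_0+i}^x\bigl(y_i\mid (y_{i-1},y_{i-2},\dots)\bigr),\qquad n\ge1,\ y_1,\dots,y_n\in E,$$ with the convention $y_{-j}=z_j$ for $j\ge0$; let $\overline Q_{t_0,x,z}$ be defined in the same way from $(\bar q_t^x)_t$. Let $(S_n)_{n\ge0}$ be the time-homogeneous Markov chain on $\mathbb N$ with $S_0=0$ and transition probabilities $P(i,i+1)=1-b_i$, $P(i,0)=b_i$ for $i\in\mathbb N$, and put $b_0^*=b_0$ and $b_n^*=\mathbb P(S_n=0)$ for $n\ge1$. Then there is a family $\widetilde Q_{t_0,x,z,\bar z}$, $(x,z,\bar z)\in\mathcal X\times E^{\mathbb N}\times E^{\mathbb N}$, of probability measures on $E^{\mathbb N^*}\times E^{\mathbb N^*}$ such that: 1. for all $x,z,\bar z$ and all measurable $A,B\subseteq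 E^{\mathbb N^*}$, $$\widetilde Q_{t_0,x,z,\bar z}(A\times E^{\mathbb N^*})=Q_{t_0,x,z}(A),\qquad \widetilde Q_{t_0,x,z,\bar z}(E^{\mathbb N^*}\times B)=\overline Q_{t_0,x,\bar z}(B);$$ 2. for all $x,z,\bar z$ and all integers $t\ge1$, $$\widetilde Q_{t_0,x,z,\bar z}\bigl(\{(y,\bar y): y_t\ne\bar y_t\}\bigr)\le b^*_{t-1}+\sup_{s\in E^{\mathbb N}}d_{TV}\bigl(q^x_{t+t_0}(\cdot\mid s),\bar q^x_{t+t_0}(\cdot\mid s)\bigr)+\sum_{\ell=0}^{t-2}b^*_\ell\,\sup_{s\in E^{\mathbb N}}d_{TV}\bigl(q^x_{t+t_0-\ell-1}(\cdot\mid s),\bar q^x_{t+t_0-\ell-1}(\cdot\mid s)\bigr);$$ 3. for every measurable $C\subseteq E^{\mathbb N^*}\times E^{\mathbb N^*}$, the map $(x,z,\bar z)\mapsto\widetilde Q_{t_0,x,z,\bar z}(C)$ is measurable on $\mathcal X\times E^{\mathbb N}\times E^{\mathbb N}$. -/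

import Mathlib

open MeasureTheory ProbabilityTheory Filter Topology

noncomputable section

namespace CompleteConnections

/-- The past `(y_n, y_{n-1}, …, y_1, z_0, z_1, …)` seen after time `n`, for a path with values
`y_1, …, y_n` at times `1, …, n` and `y_{-j} = z_j` for `j ≥ 0`. The history `h` is indexed by
`0, …, n`; its value at time `0` is not used. -/
def past {E : Type*} (z : ℕ → E) (n : ℕ) (h : Finset.Iic n → E) : ℕ → E :=
  fun j => if j < n then h ⟨n - j, Finset.mem_Iic.2 (Nat.sub_le n j)⟩ else z (j - n)

theorem measurable_past {E : Type*} [MeasurableSpace E] (z : ℕ → E) (n : ℕ) :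
    Measurable (past z n) := by
  refine measurable_pi_lambda _ fun j => ?_
  unfold past
  split_ifs
  · exact measurable_pi_apply _
  · exact measurable_const

/-- The conditional law of `y_{n+1}` given `y_1, …, y_n`: the kernel `q_{t₀+n+1}` at the past. -/
def stepKernel {E : Type*} [MeasurableSpace E] (q : ℤ → Kernel (ℕ → E) E) (t₀ : ℤ) (z : ℕ → E)
    (n : ℕ) : Kernel (Finset.Iic n → E) E :=
  (q (t₀ + n + 1)).comap (past z n) (measurable_past z n)

instance {E : Type*} [MeasurableSpace E] (q : ℤ → Kernel (ℕ → E) E) [∀ t, IsMarkovKernel (q t)]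
    (t₀ : ℤ) (z : ℕ → E) (n : ℕ) : IsMarkovKernel (stepKernel q t₀ z n) := by
  unfold stepKernel; infer_instance

/-- The law of `(y_i)_{i ≥ 1}` for the chain with complete connections that has the past `z` at
time `t₀` and the transition kernels `q_{t₀+1}, q_{t₀+2}, …`, obtained from the Ionescu-Tulcea
theorem; see `pathLaw_cylinder` for its values on cylinders. -/
def pathLaw {E : Type*} [MeasurableSpace E] (q : ℤ → Kernel (ℕ → E) E) [∀ t, IsMarkovKernel (q t)]
    (t₀ : ℤ) (z : ℕ → E) : Measure (ℕ+ → E) :=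
  (Kernel.traj (X := fun _ => E) (stepKernel q t₀ z) 0 (fun _ => z 0)).map
    (fun w (i : ℕ+) => w (i : ℕ))

/-- The values of `pathLaw` on cylinders: the probability of `y_1, …, y_n` is the product of the
transition probabilities `q_{t₀+i}(y_i | y_{i-1}, y_{i-2}, …)` for `1 ≤ i ≤ n`, where
`y_{-j} = z_j` for `j ≥ 0`. -/
theorem pathLaw_cylinder {E : Type*} [MeasurableSpace E] [MeasurableSingletonClass E]
    (q : ℤ → Kernel (ℕ → E) E) [∀ t, IsMarkovKernel (q t)] (t₀ : ℤ) (z : ℕ → E)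
    (y : ℕ → E) (n : ℕ) :
    pathLaw q t₀ z {w | ∀ i : ℕ+, (i : ℕ) ≤ n → w i = y i} =
      ∏ i ∈ Finset.range n, q (t₀ + i + 1) (past z i fun k => y k) {y (i + 1)} := by
  have hs : ∀ {ι : Type} (i : ι) (e : E),
      MeasurableSet {w : ι → E | w i = e} := fun i e =>
    (measurable_pi_apply i : Measurable fun w : _ → E => w i) (measurableSet_singleton e)
  have hm : ∀ n : ℕ, MeasurableSet {w : ℕ+ → E | ∀ i : ℕ+, (i : ℕ) ≤ n → w i = y i} := by
    intro n
    simp only [Set.ofPred_forall]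
    exact MeasurableSet.iInter fun i => MeasurableSet.iInter fun _ =>
      hs i (y i)
  have hA : ∀ n : ℕ, MeasurableSet {h : Finset.Iic n → E | ∀ i : Finset.Iic n, 1 ≤ (i : ℕ) → h i = y i} := by
    intro n
    simp only [Set.ofPred_forall]
    exact MeasurableSet.iInter fun i => MeasurableSet.iInter fun _ =>
      hs i (y i)
  have hf : Measurable fun (w : ℕ → E) (i : ℕ+) => w (i : ℕ) :=
    measurable_pi_lambda _ fun i => measurable_pi_apply _
  induction n with
  | zero =>
    have : {w : ℕ+ → E | ∀ i : ℕ+, (i : ℕ) ≤ 0 → w i = y i} = Set.univ := by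
      ext w
      simp
    rw [this, pathLaw, Measure.map_apply hf MeasurableSet.univ]
    simp
  | succ n ih =>
    rw [Finset.prod_range_succ, ← ih, pathLaw, Measure.map_apply hf (hm _),
      Measure.map_apply hf (hm _)]
    have h1 : (fun (w : ℕ → E) (i : ℕ+) => w (i : ℕ)) ⁻¹'
          {w : ℕ+ → E | ∀ i : ℕ+, (i : ℕ) ≤ n + 1 → w i = y i} =
        (fun w : ℕ → E => (Preorder.frestrictLe (π := fun _ => E) n w, w (n + 1))) ⁻¹'
          ({h : Finset.Iic n → E | ∀ i : Finset.Iic n, 1 ≤ (i : ℕ) → h i = y i} ×ˢ {y (n + 1)}) := by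
      ext w
      simp only [Set.mem_preimage, Set.mem_ofPred_eq, Set.mem_prod, Set.mem_singleton_iff]
      constructor
      · intro h
        exact ⟨fun i hi => h ⟨i, hi⟩ (by have := Finset.mem_Iic.1 i.2; simp; omega),
          h ⟨n + 1, by omega⟩ le_rfl⟩
      · rintro ⟨h, h'⟩ i hi
        rcases Nat.lt_or_ge n i with hlt | hle
        · have : (i : ℕ) = n + 1 := by omega
          rw [this, h']
        · exact h ⟨i, Finset.mem_Iic.2 hle⟩ i.pos
    have h2 : (fun (w : ℕ → E) (i : ℕ+) => w (i : ℕ)) ⁻¹'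
          {w : ℕ+ → E | ∀ i : ℕ+, (i : ℕ) ≤ n → w i = y i} =
        Preorder.frestrictLe (π := fun _ => E) n ⁻¹'
          {h : Finset.Iic n → E | ∀ i : Finset.Iic n, 1 ≤ (i : ℕ) → h i = y i} := by
      ext w
      simp only [Set.mem_preimage, Set.mem_ofPred_eq]
      constructor
      · intro h i hi
        exact h ⟨i, hi⟩ (Finset.mem_Iic.1 i.2)
      · intro h i hi
        exact h ⟨i, Finset.mem_Iic.2 hi⟩ i.pos
    rw [h1, h2, ← Measure.map_apply (by fun_prop) ((hA n).prod (measurableSet_singleton _)),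
      ← Kernel.partialTraj_compProd_eq_map_traj (Nat.zero_le n),
      ← Measure.map_apply (by fun_prop) (hA n), Kernel.traj_map_frestrictLe_apply,
      Measure.compProd_apply_prod (hA n) (measurableSet_singleton _),
      setLIntegral_congr_fun (g := fun _ =>
        q (t₀ + n + 1) (past z n fun k => y k) {y (n + 1)}) (hA n), setLIntegral_const, mul_comm]
    intro h hh
    have : past z n h = past z n fun k => y k := by
      funext j
      unfold past
      split_ifs with hj
      · exact hh _ (by simp; omega)
      · rfl
    simp only [stepKernel, Kernel.comap_apply, this]

/-- Total variation distance on a finite set. -/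
def dTV {E : Type*} [Fintype E] [MeasurableSpace E] (μ ν : Measure E) : ℝ :=
  (1 / 2) * ∑ e : E, |μ.real {e} - ν.real {e}|

/-- The continuity coefficient `b_m`: the supremum of the total variation distances between
`q_t^x(·|y)` and `q_t^x(·|y')`, over `t`, `x` and all `y, y'` with `y_i = y'_i` for `i < m`. -/
def contCoeff {E 𝒳 : Type*} [Fintype E] [MeasurableSpace E]
    (q : ℤ → 𝒳 → Kernel (ℕ → E) E) (m : ℕ) : ℝ :=
  sSup {r : ℝ | ∃ (t : ℤ) (x : 𝒳) (y y' : ℕ → E), (∀ i < m, y i = y' i) ∧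
    r = dTV (q t x y) (q t x y')}

/-- The transition kernel on `ℕ` with `P(i, i+1) = 1 - b_i` and `P(i, 0) = b_i`. -/
def renewalKernel (b : ℕ → ℝ) : Kernel ℕ ℕ where
  toFun i := ENNReal.ofReal (1 - b i) • Measure.dirac (i + 1) +
    ENNReal.ofReal (b i) • Measure.dirac 0
  measurable' := measurable_from_top

theorem isMarkovKernel_renewalKernel {b : ℕ → ℝ} (hb : ∀ i, b i ∈ Set.Icc (0 : ℝ) 1) :
    IsMarkovKernel (renewalKernel b) := by
  refine ⟨fun i => ⟨?_⟩⟩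
  have h := hb i
  simp only [renewalKernel, Kernel.coe_mk, Measure.add_apply, Measure.smul_apply, measure_univ,
    smul_eq_mul, mul_one]
  rw [← ENNReal.ofReal_add (by linarith [h.2]) h.1]
  simp

/-- The law of `(S_n)_{n ≥ 1}`, where `(S_n)_{n ≥ 0}` is the time-homogeneous Markov chain with
`S_0 = 0` and transition kernel `renewalKernel b`. A Markov chain is the chain with complete
connections whose kernel only reads the last value of the past. -/
def renewalLaw (b : ℕ → ℝ) (hb : ∀ i, b i ∈ Set.Icc (0 : ℝ) 1) : Measure (ℕ+ → ℕ) :=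
  haveI := isMarkovKernel_renewalKernel hb
  pathLaw (fun _ => (renewalKernel b).comap (fun y : ℕ → ℕ => y 0) (measurable_pi_apply 0)) 0
    (fun _ => 0)

/-- `b*_0 = b_0` and `b*_n = P(S_n = 0)` for `n ≥ 1`. -/
def starCoeff (b : ℕ → ℝ) (hb : ∀ i, b i ∈ Set.Icc (0 : ℝ) 1) : ℕ → ℝ
  | 0 => b 0
  | n + 1 => (renewalLaw b hb).real {S | S n.succPNat = 0}

theorem dTV_mem_Icc {E : Type*} [Fintype E] [MeasurableSpace E] [DiscreteMeasurableSpace E]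
    (μ ν : Measure E) [IsProbabilityMeasure μ] [IsProbabilityMeasure ν] :
    dTV μ ν ∈ Set.Icc (0 : ℝ) 1 := by
  have hs : ∀ ρ : Measure E, IsProbabilityMeasure ρ → ∑ e : E, ρ.real {e} = 1 := by
    intro ρ _
    rw [sum_measureReal_singleton]
    simp
  unfold dTV
  constructor
  · positivity
  · have h : ∑ e : E, |μ.real {e} - ν.real {e}| ≤ ∑ e : E, (μ.real {e} + ν.real {e}) := by
      refine Finset.sum_le_sum fun e _ => ?_
      rw [abs_le]
      constructor <;> linarith [measureReal_nonneg (μ := μ) (s := {e}),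
        measureReal_nonneg (μ := ν) (s := {e})]
    rw [Finset.sum_add_distrib, hs μ inferInstance, hs ν inferInstance] at h
    linarith

theorem contCoeff_mem_Icc {E 𝒳 : Type*} [Fintype E] [MeasurableSpace E]
    [DiscreteMeasurableSpace E] (q : ℤ → 𝒳 → Kernel (ℕ → E) E) [∀ t x, IsMarkovKernel (q t x)]
    (m : ℕ) : contCoeff q m ∈ Set.Icc (0 : ℝ) 1 := by
  constructor
  · refine Real.sSup_nonneg ?_
    rintro r ⟨t, x, y, y', -, rfl⟩
    exact (dTV_mem_Icc _ _).1
  · refine Real.sSup_le ?_ zero_le_one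
    rintro r ⟨t, x, y, y', -, rfl⟩
    exact (dTV_mem_Icc _ _).2

/-- The coefficients `b*_n` built from the continuity coefficients of `q`. -/
def bStar {E 𝒳 : Type*} [Fintype E] [MeasurableSpace E] [DiscreteMeasurableSpace E]
    (q : ℤ → 𝒳 → Kernel (ℕ → E) E) [∀ t x, IsMarkovKernel (q t x)] : ℕ → ℝ :=
  starCoeff (contCoeff q) (contCoeff_mem_Icc q)

end CompleteConnections

end

/-
Let the two paths move together, each step being taken by the maximal coupling of the two
conditional laws given both pasts. If the components have agreed during the last `L` steps, they
separate at the next one with probability at most `b L + δ`, where `δ` is the distance between the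
two kernels at that time, so the run length of agreement is compared with the renewal chain. Let
`u m i` be the probability that the chain started from `i` is at `0` after `m` steps. As `u m` is
antitone in `i`, the run length `L n` at time `n` satisfies
`E (u m (L (n + 1))) ≤ E (u (m + 1) (L n)) + u m 0 * δ`. The components differ at time `n` exactly
when `L n = 0`, that is with probability `E (u 0 (L n))`; iterating down to time `0` bounds it by
`u n 0` plus the sum of the `u ℓ 0 * δ`, the `δ` being taken at time `n - ℓ`. Finally, `u n 0`
decreases in `n`, so that `u (n + 1) 0` is at most the `n`-th coefficient `starCoeff`.
-/

noncomputable section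

namespace CompleteConnections

section PathCylinder

variable {E : Type*}

/-- The cylinder of paths on `ℕ+` that have the values `y 1, …, y n` at the times `1, …, n`. The
sequence `y` is indexed by `ℕ`, as in `pathLaw_cylinder`; its value at `0` plays no role. -/
def pathCylinder (n : ℕ) (y : ℕ → E) : Set (ℕ+ → E) :=
  {w | ∀ i : ℕ+, (i : ℕ) ≤ n → w i = y i}

/-- The family of all path cylinders, a generating π-system for the product σ-algebra. -/
def pathCylinders (E : Type*) : Set (Set (ℕ+ → E)) :=
  Set.range fun p : ℕ × (ℕ → E) => pathCylinder p.1 p.2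

theorem pathCylinder_zero (y : ℕ → E) : pathCylinder 0 y = Set.univ := by
  ext w
  simp [pathCylinder]

theorem pathCylinder_succ (n : ℕ) (y : ℕ → E) :
    pathCylinder (n + 1) y = pathCylinder n y ∩ {w | w n.succPNat = y (n + 1)} := by
  ext w
  refine ⟨fun h => ⟨fun i hi => h i (hi.trans n.le_succ), h _ le_rfl⟩, ?_⟩
  rintro ⟨h, h'⟩ i hi
  rcases hi.lt_or_eq with hi | hi
  · exact h i (Nat.lt_succ_iff.1 hi)
  · obtain rfl : i = n.succPNat := PNat.coe_injective hi
    exact h'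

theorem pathCylinder_eq_of_mem {n : ℕ} {y : ℕ → E} {v : ℕ+ → E} (hv : v ∈ pathCylinder n y) :
    pathCylinder n y = pathCylinder n fun k => v k.toPNat' := by
  ext w
  refine forall₂_congr fun i hi => ?_
  simp only [PNat.coe_toPNat', hv i hi]

theorem pathCylinder_inter_pathCylinder (n m : ℕ) (y : ℕ → E) :
    pathCylinder n y ∩ pathCylinder m y = pathCylinder (max n m) y := by
  ext w
  simp only [pathCylinder, Set.mem_inter_iff, Set.mem_ofPred_eq, le_max_iff, or_imp, forall_and]

theorem isPiSystem_pathCylinders (E : Type*) : IsPiSystem (pathCylinders E) := by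
  rintro _ ⟨⟨n, y⟩, rfl⟩ _ ⟨⟨m, y'⟩, rfl⟩ ⟨v, hv, hv'⟩
  refine ⟨(max n m, fun k => v k.toPNat'), ?_⟩
  simp only [pathCylinder_eq_of_mem hv, pathCylinder_eq_of_mem hv',
    pathCylinder_inter_pathCylinder]

theorem measurableSet_pathCylinder [MeasurableSpace E] [MeasurableSingletonClass E] (n : ℕ)
    (y : ℕ → E) : MeasurableSet (pathCylinder n y) := by
  simp only [pathCylinder, Set.ofPred_forall]
  exact MeasurableSet.iInter fun i => MeasurableSet.iInter fun _ =>
    measurable_pi_apply (X := fun _ : ℕ+ => E) i (measurableSet_singleton _)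

theorem preimage_eval_eq_iUnion_pathCylinder (i : ℕ+) (e : E) :
    (fun w : ℕ+ → E => w i) ⁻¹' {e} =
      ⋃ g : Fin i → E, pathCylinder i fun j => if h : j < i then g ⟨j, h⟩ else e := by
  ext w
  simp only [Set.mem_preimage, Set.mem_singleton_iff, Set.mem_iUnion]
  refine ⟨fun hw => ⟨fun j => w (j : ℕ).toPNat', fun j hj => ?_⟩, ?_⟩
  · rcases hj.lt_or_eq with hj | hj
    · simp [hj]
    · simp [PNat.coe_injective hj, hw]
  · rintro ⟨g, hg⟩
    simpa using hg i le_rfl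

theorem generateFrom_pathCylinders (E : Type*) [Countable E] [MeasurableSpace E]
    [MeasurableSingletonClass E] :
    (MeasurableSpace.pi : MeasurableSpace (ℕ+ → E)) =
      MeasurableSpace.generateFrom (pathCylinders E) := by
  apply le_antisymm
  · refine iSup_le fun i => ?_
    rw [← measurable_iff_comap_le]
    refine @measurable_to_countable' E (ℕ+ → E) _ _ (MeasurableSpace.generateFrom _) _ fun e => ?_
    rw [preimage_eval_eq_iUnion_pathCylinder]
    exact MeasurableSet.iUnion fun g => MeasurableSpace.measurableSet_generateFrom ⟨(i, _), rfl⟩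
  · refine MeasurableSpace.generateFrom_le ?_
    rintro _ ⟨⟨n, y⟩, rfl⟩
    exact measurableSet_pathCylinder n y

end PathCylinder

section Past

variable {E : Type*}

/-- The history of a path up to time `n`, in the form expected by `past` and `stepKernel`. -/
abbrev history (n : ℕ) (w : ℕ → E) : Finset.Iic n → E :=
  Preorder.frestrictLe (π := fun _ => E) n w

theorem past_succ_zero (z : ℕ → E) (n : ℕ) (w : ℕ → E) :
    past z (n + 1) (history (n + 1) w) 0 = w (n + 1) := by
  simp [past]

theorem past_succ_succ (z : ℕ → E) (n : ℕ) (w : ℕ → E) (i : ℕ) :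
    past z (n + 1) (history (n + 1) w) (i + 1) = past z n (history n w) i := by
  simp [past]

theorem comp_past {F : Type*} (f : E → F) (z : ℕ → E) (n : ℕ) (h : Finset.Iic n → E) :
    (fun i => f (past z n h i)) = past (fun j => f (z j)) n fun k => f (h k) := by
  funext i
  simp only [past, apply_ite f]

theorem past_congr (z : ℕ → E) (n : ℕ) {h h' : Finset.Iic n → E}
    (hh : ∀ k : Finset.Iic n, 1 ≤ (k : ℕ) → h k = h' k) : past z n h = past z n h' := by
  funext j
  unfold past
  split_ifs with hj
  · exact hh _ (Nat.sub_pos_of_lt hj)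
  · rfl

theorem measurable_past_left [MeasurableSpace E] (n : ℕ) (h : Finset.Iic n → E) :
    Measurable fun z : ℕ → E => past z n h := by
  refine measurable_pi_lambda _ fun j => ?_
  unfold past
  split_ifs
  · exact measurable_const
  · exact measurable_pi_apply _

end Past

section PathLaw

variable {E : Type*} [MeasurableSpace E] (q : ℤ → Kernel (ℕ → E) E) [∀ t, IsMarkovKernel (q t)]
  (t₀ : ℤ) (z : ℕ → E)

/-- The law on `ℕ → E` given by the Ionescu-Tulcea theorem, whose image on `ℕ+ → E` is
`pathLaw`. -/
abbrev trajLaw : Measure (ℕ → E) :=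
  Kernel.traj (X := fun _ => E) (stepKernel q t₀ z) 0 (fun _ => z 0)

instance : IsProbabilityMeasure (pathLaw q t₀ z) :=
  Measure.isProbabilityMeasure_map
    (measurable_pi_lambda _ fun _ => measurable_pi_apply _).aemeasurable

theorem pathLaw_apply {A : Set (ℕ+ → E)} (hA : MeasurableSet A) :
    pathLaw q t₀ z A = trajLaw q t₀ z {w | (fun i : ℕ+ => w i) ∈ A} :=
  Measure.map_apply (by fun_prop) hA

theorem map_history_succ_trajLaw (n : ℕ) :
    (trajLaw q t₀ z).map (fun w => (history n w, w (n + 1))) =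
      (trajLaw q t₀ z).map (history n) ⊗ₘ stepKernel q t₀ z n := by
  rw [← Kernel.partialTraj_compProd_eq_map_traj (Nat.zero_le n),
    Kernel.traj_map_frestrictLe_apply]

theorem lintegral_trajLaw_succ (n : ℕ) {F : (Finset.Iic n → E) × E → ENNReal}
    (hF : Measurable F) :
    ∫⁻ w, F (history n w, w (n + 1)) ∂trajLaw q t₀ z =
      ∫⁻ w, ∫⁻ e, F (history n w, e) ∂q (t₀ + n + 1) (past z n (history n w))
        ∂trajLaw q t₀ z := by
  rw [← lintegral_map hF (g := fun w => (history n w, w (n + 1))) (by fun_prop),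
    map_history_succ_trajLaw, Measure.lintegral_compProd hF,
    lintegral_map hF.lintegral_kernel_prod_right' (by fun_prop)]
  rfl

theorem trajLaw_preimage_history_inter (n : ℕ) {A : Set (Finset.Iic n → E)}
    (hA : MeasurableSet A) {B : Set E} (hB : MeasurableSet B) :
    trajLaw q t₀ z (history n ⁻¹' A ∩ {w | w (n + 1) ∈ B}) =
      ∫⁻ w in history n ⁻¹' A, q (t₀ + n + 1) (past z n (history n w)) B ∂trajLaw q t₀ z := by
  change trajLaw q t₀ z ((fun w => (history n w, w (n + 1))) ⁻¹' (A ×ˢ B)) = _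
  rw [← Measure.map_apply (by fun_prop) (hA.prod hB), map_history_succ_trajLaw,
    Measure.compProd_apply_prod hA hB,
    setLIntegral_map hA (Kernel.measurable_coe _ hB) (by fun_prop)]
  rfl

variable {F : Type*} [MeasurableSpace F] [MeasurableSingletonClass F]
  {f : E → F} (hf : Measurable f) (r : ℤ → Kernel (ℕ → F) F)
  (hqr : ∀ t v, (q t v).map f = r t fun i => f (v i))

include hf hqr in
theorem pathLaw_preimage_pathCylinder (n : ℕ) (y : ℕ → F) :
    pathLaw q t₀ z ((fun w i => f (w i)) ⁻¹' pathCylinder n y) =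
      ∏ i ∈ Finset.range n,
        r (t₀ + i + 1) (past (fun j => f (z j)) i fun k => y k) {y (i + 1)} := by
  have hf' : Measurable fun (w : ℕ+ → E) (i : ℕ+) => f (w i) := by fun_prop
  induction n with
  | zero => simp [pathCylinder_zero]
  | succ n ih =>
    set A : Set (Finset.Iic n → E) := {h | ∀ k : Finset.Iic n, 1 ≤ (k : ℕ) → f (h k) = y k} with hA
    have hA_meas : MeasurableSet A := by
      simp only [hA, Set.ofPred_forall]
      exact MeasurableSet.iInter fun k => MeasurableSet.iInter fun _ =>
        (hf.comp (measurable_pi_apply k)) (measurableSet_singleton _)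
    have h_history_meas : MeasurableSet (history n ⁻¹' A) := hA_meas.preimage (by fun_prop)
    have h_cylinder : {w : ℕ → E | (fun i : ℕ+ => f (w i)) ∈ pathCylinder n y} =
        history n ⁻¹' A := by
      ext w
      exact ⟨fun h k hk => h ⟨k, hk⟩ (Finset.mem_Iic.1 k.2),
        fun h i hi => h ⟨i, Finset.mem_Iic.2 hi⟩ i.pos⟩
    have h_step : ∀ h ∈ A, q (t₀ + n + 1) (past z n h) (f ⁻¹' {y (n + 1)}) =
        r (t₀ + n + 1) (past (fun j => f (z j)) n fun k => y k) {y (n + 1)} := fun h hh => by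
      rw [← Measure.map_apply hf (measurableSet_singleton _), hqr, comp_past,
        past_congr _ n (h' := fun k => y k) hh]
    rw [Finset.prod_range_succ, ← ih, pathCylinder_succ, Set.preimage_inter]
    rw [pathLaw_apply, pathLaw_apply]
    · change trajLaw q t₀ z ({w | (fun i : ℕ+ => f (w i)) ∈ pathCylinder n y} ∩
        {w | w (n + 1) ∈ f ⁻¹' {y (n + 1)}}) =
          trajLaw q t₀ z {w | (fun i : ℕ+ => f (w i)) ∈ pathCylinder n y} * _
      rw [h_cylinder,
        trajLaw_preimage_history_inter q t₀ z n hA_meas (hf (measurableSet_singleton _)),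
        setLIntegral_congr_fun h_history_meas fun w hw => h_step _ hw,
        setLIntegral_const, mul_comm]
    · exact hf' (measurableSet_pathCylinder n y)
    · rw [← Set.preimage_inter, ← pathCylinder_succ]
      exact hf' (measurableSet_pathCylinder _ y)

include hqr in
theorem map_pathLaw [Countable F] [∀ t, IsMarkovKernel (r t)] (hf : Measurable f) :
    (pathLaw q t₀ z).map (fun w i => f (w i)) = pathLaw r t₀ fun j => f (z j) := by
  have hf' : Measurable fun (w : ℕ+ → E) (i : ℕ+) => f (w i) := by fun_prop
  have := Measure.isProbabilityMeasure_map (μ := pathLaw q t₀ z) hf'.aemeasurable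
  refine ext_of_generate_finite _ (generateFrom_pathCylinders F) (isPiSystem_pathCylinders F) ?_
    (by simp)
  rintro _ ⟨⟨n, y⟩, rfl⟩
  rw [Measure.map_apply hf' (measurableSet_pathCylinder n y),
    pathLaw_preimage_pathCylinder q t₀ z hf r hqr]
  exact (pathLaw_cylinder r t₀ _ y n).symm

theorem measurable_pathLaw {Ω : Type*} [MeasurableSpace Ω] [Countable E]
    [MeasurableSingletonClass E] {q : Ω → ℤ → Kernel (ℕ → E) E} [∀ ω t, IsMarkovKernel (q ω t)]
    (hq : ∀ t, Measurable fun p : Ω × (ℕ → E) => q p.1 t p.2) {z : Ω → ℕ → E}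
    (hz : Measurable z) (t₀ : ℤ) : Measurable fun ω => pathLaw (q ω) t₀ (z ω) := by
  refine Measurable.measure_of_isPiSystem_of_isProbabilityMeasure
    (generateFrom_pathCylinders E) (isPiSystem_pathCylinders E) ?_
  rintro _ ⟨⟨n, y⟩, rfl⟩
  simp only [pathCylinder, pathLaw_cylinder]
  refine Finset.measurable_prod _ fun i _ => ?_
  have h_past : Measurable fun ω => past (z ω) i fun k => y k :=
    (measurable_past_left i fun k => y k).comp hz
  exact (Measure.measurable_coe (measurableSet_singleton (y (i + 1)))).comp
    ((hq (t₀ + i + 1)).comp (measurable_id.prodMk h_past))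

theorem map_past_zero_trajLaw (P : Kernel E E) [IsMarkovKernel P] (n : ℕ) :
    (trajLaw (fun _ => P.comap (fun y : ℕ → E => y 0) (measurable_pi_apply 0)) t₀ z).map
      (fun w => past z n (history n w) 0) = (P ^ n) (z 0) := by
  induction n with
  | zero =>
    have h_const : (fun w : ℕ → E => past z 0 (history 0 w) 0) = fun _ => z 0 := by
      funext w
      simp [past]
    rw [h_const, Measure.map_const, measure_univ, one_smul, pow_zero]
    exact (Kernel.id_apply _).symm
  | succ n ih =>
    ext s hs
    have hpast : Measurable fun w : ℕ → E => past z n (history n w) 0 :=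
      (measurable_pi_apply 0).comp ((measurable_past z n).comp (by fun_prop))
    have h_step := trajLaw_preimage_history_inter
      (fun _ => P.comap (fun y : ℕ → E => y 0) (measurable_pi_apply 0)) t₀ z n
      MeasurableSet.univ hs
    simp only [Set.preimage_univ, Set.univ_inter, setLIntegral_univ, Kernel.comap_apply] at h_step
    simp only [past_succ_zero]
    rw [Measure.map_apply (measurable_pi_apply _) hs, Kernel.pow_succ_apply_eq_lintegral P n _ hs,
      ← ih, lintegral_map (P.measurable_coe hs) hpast]
    exact h_step

end PathLaw

section Coupling

theorem measurable_measure_of_singleton {Ω E : Type*} [MeasurableSpace Ω] [Countable E]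
    [MeasurableSpace E] [MeasurableSingletonClass E] {μ : Ω → Measure E}
    (hμ : ∀ e, Measurable fun ω => μ ω {e}) : Measurable μ := by
  refine Measure.measurable_of_measurable_coe _ fun s hs => ?_
  simp only [← Measure.tsum_indicator_apply_singleton _ s hs]
  refine Measurable.tsum fun e => ?_
  by_cases he : e ∈ s
  · simpa only [Set.indicator_of_mem he] using hμ e
  · simpa only [Set.indicator_of_notMem he] using measurable_const

theorem measurable_kernel_uncurry_of_singleton {Ω S E : Type*} [MeasurableSpace Ω]
    [MeasurableSpace S] [Countable E] [MeasurableSpace E] [MeasurableSingletonClass E]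
    {κ : Ω → Kernel S E}
    (hκ : Measurable fun p : E × S × Ω => κ p.2.2 p.2.1 {p.1}) :
    Measurable fun p : Ω × S => κ p.1 p.2 :=
  measurable_measure_of_singleton fun _ =>
    hκ.comp (measurable_const.prodMk measurable_swap)

variable {E : Type*} [Fintype E] [MeasurableSpace E]

theorem dTV_nonneg (μ ν : Measure E) : 0 ≤ dTV μ ν := by
  unfold dTV
  positivity

theorem dTV_comm (μ ν : Measure E) : dTV μ ν = dTV ν μ := by
  simp only [dTV, abs_sub_comm]

theorem dTV_triangle (μ ν ρ : Measure E) : dTV μ ρ ≤ dTV μ ν + dTV ν ρ := by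
  unfold dTV
  rw [← mul_add, ← Finset.sum_add_distrib]
  gcongr
  exact abs_sub_le _ _ _

open Classical in
/-- The weights of the maximal coupling of two probability measures on a finite set: the common
mass `min μ ν` sits on the diagonal, and the excesses of `μ` over `ν` and of `ν` over `μ` are
coupled independently. If `dTV μ ν = 0` then both excesses vanish, and so does the quotient. -/
def couplingWeight (μ ν : Measure E) (p : E × E) : ℝ :=
  (if p.1 = p.2 then min (μ.real {p.1}) (ν.real {p.1}) else 0) +
    (μ.real {p.1} - ν.real {p.1})⁺ * (ν.real {p.2} - μ.real {p.2})⁺ / dTV μ ν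

/-- The maximal coupling of two probability measures on a finite set: a measure on `E × E` with
marginals `μ` and `ν` that charges the complement of the diagonal by at most `dTV μ ν`. -/
def maxCoupling (μ ν : Measure E) : Measure (E × E) :=
  ∑ p : E × E, ENNReal.ofReal (couplingWeight μ ν p) • Measure.dirac p

theorem couplingWeight_nonneg (μ ν : Measure E) (p : E × E) : 0 ≤ couplingWeight μ ν p := by
  have h_excess : 0 ≤ (μ.real {p.1} - ν.real {p.1})⁺ * (ν.real {p.2} - μ.real {p.2})⁺ / dTV μ ν :=
    div_nonneg (mul_nonneg (posPart_nonneg _) (posPart_nonneg _)) (dTV_nonneg μ ν)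
  unfold couplingWeight
  positivity

theorem couplingWeight_swap (μ ν : Measure E) (p : E × E) :
    couplingWeight ν μ p.swap = couplingWeight μ ν p := by
  rcases p with ⟨e, e'⟩
  simp only [couplingWeight, Prod.swap_prod_mk, dTV_comm ν μ]
  rw [mul_comm]
  congr 1
  by_cases h : e = e'
  · rw [h, min_comm]
  · rw [if_neg h, if_neg (Ne.symm h)]

variable [DiscreteMeasurableSpace E]

theorem measurable_maxCoupling {Ω : Type*} [MeasurableSpace Ω] {μ ν : Ω → Measure E}
    (hμ : Measurable μ) (hν : Measurable ν) : Measurable fun ω => maxCoupling (μ ω) (ν ω) := by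
  have hμ_real (e : E) : Measurable fun ω => (μ ω).real {e} :=
    ((Measure.measurable_coe .of_discrete).comp hμ).ennreal_toReal
  have hν_real (e : E) : Measurable fun ω => (ν ω).real {e} :=
    ((Measure.measurable_coe .of_discrete).comp hν).ennreal_toReal
  have h_dTV : Measurable fun ω => dTV (μ ω) (ν ω) :=
    (Finset.measurable_fun_sum _ fun e _ => ((hμ_real e).sub (hν_real e)).abs).const_mul _
  have h_weight (p : E × E) : Measurable fun ω => couplingWeight (μ ω) (ν ω) p := by
    refine .add (.ite (.const _) ((hμ_real _).min (hν_real _)) measurable_const)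
      (.div (.mul ?_ ?_) h_dTV)
    · exact ((hμ_real _).sub (hν_real _)).sup_const 0
    · exact ((hν_real _).sub (hμ_real _)).sup_const 0
  refine Measure.measurable_of_measurable_coe _ fun s _ => ?_
  simp only [maxCoupling, Measure.coe_finsetSum, Finset.sum_apply, Measure.smul_apply,
    smul_eq_mul]
  exact Finset.measurable_fun_sum _ fun p _ => (h_weight p).ennreal_ofReal.mul_const _

theorem maxCoupling_singleton (μ ν : Measure E) (p : E × E) :
    maxCoupling μ ν {p} = ENNReal.ofReal (couplingWeight μ ν p) := by
  classical
  simp only [maxCoupling, Measure.coe_finsetSum, Finset.sum_apply, Measure.smul_apply,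
    smul_eq_mul]
  rw [Finset.sum_eq_single p]
  · simp
  · intro p' _ hp'
    simp [hp']
  · simp

theorem maxCoupling_finset (μ ν : Measure E) (s : Finset (E × E)) :
    maxCoupling μ ν s = ENNReal.ofReal (∑ p ∈ s, couplingWeight μ ν p) := by
  rw [← sum_measure_singleton, ENNReal.ofReal_sum_of_nonneg
    (fun p _ => couplingWeight_nonneg μ ν p)]
  simp only [maxCoupling_singleton]

theorem map_swap_maxCoupling (μ ν : Measure E) :
    (maxCoupling μ ν).map Prod.swap = maxCoupling ν μ := by
  refine Measure.ext_of_singleton fun p => ?_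
  rw [Measure.map_apply measurable_swap .of_discrete, ← Set.image_swap_eq_preimage_swap,
    Set.image_singleton, maxCoupling_singleton, maxCoupling_singleton, couplingWeight_swap]

variable (μ ν : Measure E) [IsProbabilityMeasure μ] [IsProbabilityMeasure ν]

theorem sum_posPart_sub_eq_dTV : ∑ e, (μ.real {e} - ν.real {e})⁺ = dTV μ ν := by
  have h_total : ∑ e, (μ.real {e} - ν.real {e}) = 0 := by
    simp [sum_measureReal_singleton]
  have h_double : ∑ e, (|μ.real {e} - ν.real {e}| + (μ.real {e} - ν.real {e})) =
      2 * ∑ e, (μ.real {e} - ν.real {e})⁺ := by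
    simp only [abs_add_eq_two_nsmul_posPart, nsmul_eq_mul, Nat.cast_ofNat, Finset.mul_sum]
  rw [Finset.sum_add_distrib, h_total, add_zero] at h_double
  rw [dTV, h_double]
  ring

theorem posPart_sub_le_dTV (e : E) : (μ.real {e} - ν.real {e})⁺ ≤ dTV μ ν :=
  (Finset.single_le_sum (fun e' _ => posPart_nonneg (μ.real {e'} - ν.real {e'}))
    (Finset.mem_univ e)).trans_eq (sum_posPart_sub_eq_dTV μ ν)

theorem sum_couplingWeight (e : E) : ∑ e', couplingWeight μ ν (e, e') = μ.real {e} := by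
  classical
  have h_cancel : (μ.real {e} - ν.real {e})⁺ * dTV μ ν / dTV μ ν = (μ.real {e} - ν.real {e})⁺ :=
    mul_div_cancel_of_imp fun h =>
      le_antisymm ((posPart_sub_le_dTV μ ν e).trans_eq h) (posPart_nonneg _)
  simp only [couplingWeight, Finset.sum_add_distrib, Finset.sum_ite_eq, Finset.mem_univ, if_true]
  rw [← Finset.sum_div, ← Finset.mul_sum, sum_posPart_sub_eq_dTV, dTV_comm ν μ, h_cancel,
    posPart_def]
  grind

theorem fst_maxCoupling : (maxCoupling μ ν).fst = μ := by
  classical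
  refine Measure.ext_of_singleton fun e => ?_
  have h : (Prod.fst ⁻¹' {e} : Set (E × E)) = ({e} ×ˢ Finset.univ : Finset (E × E)) := by
    ext p
    simp [Prod.ext_iff, eq_comm]
  rw [Measure.fst_apply .of_discrete, h, maxCoupling_finset, Finset.sum_product,
    Finset.sum_singleton, sum_couplingWeight, ofReal_measureReal]

theorem snd_maxCoupling : (maxCoupling μ ν).snd = ν := by
  rw [← Measure.fst_map_swap, map_swap_maxCoupling, fst_maxCoupling]

instance : IsProbabilityMeasure (maxCoupling μ ν) :=
  ⟨by rw [← Measure.fst_univ, fst_maxCoupling, measure_univ]⟩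

theorem maxCoupling_ne_le : maxCoupling μ ν {p | p.1 ≠ p.2} ≤ ENNReal.ofReal (dTV μ ν) := by
  classical
  have h_set : {p : E × E | p.1 ≠ p.2} =
      (Finset.univ.filter fun p : E × E => p.1 ≠ p.2 : Finset (E × E)) := by
    ext p
    simp
  rw [h_set, maxCoupling_finset]
  refine ENNReal.ofReal_le_ofReal ?_
  calc ∑ p with p.1 ≠ p.2, couplingWeight μ ν p
      = ∑ p : E × E with p.1 ≠ p.2,
          (μ.real {p.1} - ν.real {p.1})⁺ * (ν.real {p.2} - μ.real {p.2})⁺ / dTV μ ν :=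
        Finset.sum_congr rfl fun p hp => by
          rw [couplingWeight, if_neg (Finset.mem_filter.1 hp).2, zero_add]
    _ ≤ ∑ p : E × E, (μ.real {p.1} - ν.real {p.1})⁺ * (ν.real {p.2} - μ.real {p.2})⁺ / dTV μ ν :=
        Finset.sum_le_sum_of_subset_of_nonneg (Finset.filter_subset _ _) fun p _ _ =>
          div_nonneg (mul_nonneg (posPart_nonneg _) (posPart_nonneg _)) (dTV_nonneg μ ν)
    _ = dTV μ ν * dTV μ ν / dTV μ ν := by
        rw [← Finset.sum_div, Fintype.sum_prod_type]
        simp only [← Finset.mul_sum, ← Finset.sum_mul, sum_posPart_sub_eq_dTV,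
          dTV_comm ν μ]
    _ = dTV μ ν := mul_self_div_self _

/-- The kernel that moves a pair of pasts by the maximal coupling of the two transition laws. -/
def coupledKernel (κ η : Kernel (ℕ → E) E) : Kernel (ℕ → E × E) (E × E) where
  toFun v := maxCoupling (κ fun i => (v i).1) (η fun i => (v i).2)
  measurable' := by
    have h_fst : Measurable fun (v : ℕ → E × E) i => (v i).1 := by fun_prop
    have h_snd : Measurable fun (v : ℕ → E × E) i => (v i).2 := by fun_prop
    exact measurable_maxCoupling (κ.measurable.comp h_fst) (η.measurable.comp h_snd)

theorem coupledKernel_apply (κ η : Kernel (ℕ → E) E) (v : ℕ → E × E) :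
    coupledKernel κ η v = maxCoupling (κ fun i => (v i).1) (η fun i => (v i).2) := rfl

instance (κ η : Kernel (ℕ → E) E) [IsMarkovKernel κ] [IsMarkovKernel η] :
    IsMarkovKernel (coupledKernel κ η) :=
  ⟨fun v => by rw [coupledKernel_apply]; infer_instance⟩

end Coupling

section Renewal

/-- `returnProb b m i` is the probability that the chain with kernel `renewalKernel b` started
from `i` is at `0` after `m` steps, in the form of the backward recursion that the run length of
a coupling satisfies; see `renewalKernel_pow_apply_zero`. -/
def returnProb (b : ℕ → ℝ) : ℕ → ℕ → ℝ
  | 0, i => if i = 0 then 1 else 0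
  | m + 1, i => b i * returnProb b m 0 + (1 - b i) * returnProb b m (i + 1)

variable {b : ℕ → ℝ} (hb : ∀ i, b i ∈ Set.Icc (0 : ℝ) 1)
include hb

theorem returnProb_nonneg (m i : ℕ) : 0 ≤ returnProb b m i := by
  induction m generalizing i with
  | zero => unfold returnProb; positivity
  | succ m ih =>
    exact add_nonneg (mul_nonneg (hb i).1 (ih 0)) (mul_nonneg (sub_nonneg.2 (hb i).2) (ih _))

theorem returnProb_antitone (hanti : Antitone b) (m : ℕ) : Antitone (returnProb b m) := by
  refine antitone_nat_of_succ_le fun i => ?_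
  induction m generalizing i with
  | zero => by_cases hi : i = 0 <;> simp [returnProb, hi]
  | succ m ih =>
    have h_zero : returnProb b m (i + 1) ≤ returnProb b m 0 :=
      antitone_nat_of_succ_le ih (Nat.zero_le (i + 1))
    calc b (i + 1) * returnProb b m 0 + (1 - b (i + 1)) * returnProb b m (i + 2)
        ≤ b (i + 1) * returnProb b m 0 + (1 - b (i + 1)) * returnProb b m (i + 1) := by
          gcongr
          · exact sub_nonneg.2 (hb _).2
          · exact ih (i + 1)
      _ ≤ b i * returnProb b m 0 + (1 - b i) * returnProb b m (i + 1) := by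
          linarith [mul_le_mul_of_nonneg_right (hanti (Nat.le_succ i)) (sub_nonneg.2 h_zero)]

theorem returnProb_succ_zero_le (hanti : Antitone b) (m : ℕ) :
    returnProb b (m + 1) 0 ≤ returnProb b m 0 :=
  calc b 0 * returnProb b m 0 + (1 - b 0) * returnProb b m 1
      ≤ b 0 * returnProb b m 0 + (1 - b 0) * returnProb b m 0 := by
        gcongr
        · exact sub_nonneg.2 (hb 0).2
        · exact returnProb_antitone hb hanti m zero_le_one
    _ = returnProb b m 0 := by ring

omit hb in
theorem lintegral_renewalKernel (g : ℕ → ENNReal) (i : ℕ) :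
    ∫⁻ j, g j ∂renewalKernel b i =
      ENNReal.ofReal (1 - b i) * g (i + 1) + ENNReal.ofReal (b i) * g 0 := by
  change ∫⁻ j, g j ∂(ENNReal.ofReal (1 - b i) • Measure.dirac (i + 1) +
    ENNReal.ofReal (b i) • Measure.dirac 0) = _
  simp only [lintegral_add_measure, lintegral_smul_measure, lintegral_dirac, smul_eq_mul]

theorem renewalKernel_pow_apply_zero (m i : ℕ) :
    (renewalKernel b ^ m) i {0} = ENNReal.ofReal (returnProb b m i) := by
  induction m generalizing i with
  | zero =>
    rw [pow_zero]
    change Kernel.id i {0} = _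
    rw [Kernel.id_apply, Measure.dirac_apply' _ (measurableSet_singleton 0)]
    by_cases hi : i = 0 <;> simp [hi, returnProb]
  | succ m ih =>
    have h_zero := mul_nonneg (hb i).1 (returnProb_nonneg hb m 0)
    have h_succ := mul_nonneg (sub_nonneg.2 (hb i).2) (returnProb_nonneg hb m (i + 1))
    rw [add_comm, Kernel.pow_add_apply_eq_lintegral _ _ _ _ (measurableSet_singleton 0), pow_one,
      lintegral_renewalKernel, ih, ih, ← ENNReal.ofReal_mul (sub_nonneg.2 (hb i).2),
      ← ENNReal.ofReal_mul (hb i).1, ← ENNReal.ofReal_add h_succ h_zero, add_comm 1 m,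
      returnProb, add_comm (b i * _)]

theorem starCoeff_zero : starCoeff b hb 0 = returnProb b 1 0 := by
  simp [starCoeff, returnProb]

theorem starCoeff_succ (n : ℕ) : starCoeff b hb (n + 1) = returnProb b (n + 1) 0 := by
  have := isMarkovKernel_renewalKernel hb
  have h_set : MeasurableSet {S : ℕ+ → ℕ | S n.succPNat = 0} :=
    measurable_pi_apply n.succPNat (measurableSet_singleton 0)
  have h_law : renewalLaw b hb {S | S n.succPNat = 0} = (renewalKernel b ^ (n + 1)) 0 {0} := by
    rw [renewalLaw, pathLaw_apply _ _ _ h_set,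
      ← map_past_zero_trajLaw 0 (fun _ => 0) (renewalKernel b) (n + 1)]
    simp only [past_succ_zero]
    rw [Measure.map_apply (measurable_pi_apply _) (measurableSet_singleton 0)]
    rfl
  rw [starCoeff, measureReal_def, h_law, renewalKernel_pow_apply_zero hb,
    ENNReal.toReal_ofReal (returnProb_nonneg hb _ _)]

theorem returnProb_le_starCoeff (hanti : Antitone b) (n : ℕ) :
    returnProb b (n + 1) 0 ≤ starCoeff b hb n := by
  cases n with
  | zero => exact (starCoeff_zero hb).ge
  | succ n => exact (returnProb_succ_zero_le hb hanti _).trans_eq (starCoeff_succ hb n).symm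

end Renewal

section RunLength

variable {E : Type*}

open Classical in
/-- The number of consecutive agreements of the two components of a history, counted backwards
from time `n` and down to time `1`. -/
def runLength : (n : ℕ) → (Finset.Iic n → E × E) → ℕ
  | 0, _ => 0
  | n + 1, h =>
    if (h ⟨n + 1, Finset.mem_Iic.2 le_rfl⟩).1 = (h ⟨n + 1, Finset.mem_Iic.2 le_rfl⟩).2 then
      runLength n (Preorder.frestrictLe₂ (π := fun _ => E × E) (Nat.le_succ n) h) + 1
    else 0

open Classical in
theorem runLength_succ (n : ℕ) (w : ℕ → E × E) :
    runLength (n + 1) (history (n + 1) w) =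
      if (w (n + 1)).1 = (w (n + 1)).2 then runLength n (history n w) + 1 else 0 := rfl

theorem runLength_succ_eq_zero_iff (n : ℕ) (w : ℕ → E × E) :
    runLength (n + 1) (history (n + 1) w) = 0 ↔ (w (n + 1)).1 ≠ (w (n + 1)).2 := by
  simp [runLength_succ]

theorem past_fst_eq_past_snd_of_lt_runLength (v : ℕ → E × E) {n : ℕ} {w : ℕ → E × E} {i : ℕ}
    (hi : i < runLength n (history n w)) :
    (past v n (history n w) i).1 = (past v n (history n w) i).2 := by
  induction n generalizing i with
  | zero => exact absurd hi (Nat.not_lt_zero i)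
  | succ n ih =>
    rw [runLength_succ] at hi
    split_ifs at hi with hw
    · cases i with
      | zero => rwa [past_succ_zero]
      | succ i =>
        rw [past_succ_succ]
        exact ih (Nat.lt_of_succ_lt_succ hi)
    · exact absurd hi (Nat.not_lt_zero i)

end RunLength

section Disagreement

variable {b : ℕ → ℝ} (hb : ∀ i, b i ∈ Set.Icc (0 : ℝ) 1) (hanti : Antitone b)

include hb hanti in
theorem lintegral_returnProb_ite_le {Ω : Type*} [MeasurableSpace Ω] (ρ : Measure Ω)
    [IsProbabilityMeasure ρ] {A : Set Ω} (hA : MeasurableSet A) [DecidablePred (· ∈ A)] {i : ℕ}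
    {δ : ℝ} (hδ : 0 ≤ δ) (hρ : ρ Aᶜ ≤ ENNReal.ofReal (b i + δ)) (m : ℕ) :
    ∫⁻ ω, ENNReal.ofReal (returnProb b m (if ω ∈ A then i + 1 else 0)) ∂ρ ≤
      ENNReal.ofReal (returnProb b (m + 1) i) + ENNReal.ofReal (returnProb b m 0 * δ) := by
  set u := returnProb b m
  have h_succ : 0 ≤ u (i + 1) := returnProb_nonneg hb m _
  have h_drop : 0 ≤ u 0 - u (i + 1) :=
    sub_nonneg.2 (returnProb_antitone hb hanti m (Nat.zero_le _))
  have h_fail : 0 ≤ b i + δ := add_nonneg (hb i).1 hδ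
  have h_split : ∀ ω, ENNReal.ofReal (u (if ω ∈ A then i + 1 else 0)) =
      ENNReal.ofReal (u (i + 1)) +
        Aᶜ.indicator (fun _ => ENNReal.ofReal (u 0 - u (i + 1))) ω := fun ω => by
    by_cases hω : ω ∈ A
    · simp [hω]
    · simp [hω, ← ENNReal.ofReal_add h_succ h_drop]
  calc ∫⁻ ω, ENNReal.ofReal (u (if ω ∈ A then i + 1 else 0)) ∂ρ
      = ENNReal.ofReal (u (i + 1)) + ENNReal.ofReal (u 0 - u (i + 1)) * ρ Aᶜ := by
        simp only [h_split]
        rw [lintegral_add_left measurable_const, lintegral_const, measure_univ, mul_one,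
          lintegral_indicator_const hA.compl]
    _ ≤ ENNReal.ofReal (u (i + 1)) +
          ENNReal.ofReal (u 0 - u (i + 1)) * ENNReal.ofReal (b i + δ) := by gcongr
    _ = ENNReal.ofReal (u (i + 1) + (u 0 - u (i + 1)) * (b i + δ)) := by
        rw [← ENNReal.ofReal_mul h_drop, ← ENNReal.ofReal_add h_succ (mul_nonneg h_drop h_fail)]
    _ ≤ ENNReal.ofReal (returnProb b (m + 1) i + u 0 * δ) := by
        refine ENNReal.ofReal_le_ofReal ?_
        simp only [returnProb]
        linarith [mul_nonneg h_succ hδ]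
    _ ≤ ENNReal.ofReal (returnProb b (m + 1) i) + ENNReal.ofReal (u 0 * δ) :=
        ENNReal.ofReal_add_le

variable {E : Type*} [Countable E] [MeasurableSpace E] [DiscreteMeasurableSpace E]
  {κ : ℤ → Kernel (ℕ → E × E) (E × E)} [∀ t, IsMarkovKernel (κ t)]
  {δ : ℤ → ℝ} (hδ : ∀ t, 0 ≤ δ t)
  (hκ : ∀ t v m, (∀ i < m, (v i).1 = (v i).2) →
    κ t v {p | p.1 ≠ p.2} ≤ ENNReal.ofReal (b m + δ t))
  (t₀ : ℤ) (v : ℕ → E × E)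

include hb hanti hδ hκ

theorem lintegral_returnProb_runLength_succ_le (n m : ℕ) :
    ∫⁻ w, ENNReal.ofReal (returnProb b m (runLength (n + 1) (history (n + 1) w)))
        ∂trajLaw κ t₀ v ≤
      ∫⁻ w, ENNReal.ofReal (returnProb b (m + 1) (runLength n (history n w))) ∂trajLaw κ t₀ v +
        ENNReal.ofReal (returnProb b m 0 * δ (t₀ + n + 1)) := by
  classical
  calc ∫⁻ w, ENNReal.ofReal (returnProb b m (runLength (n + 1) (history (n + 1) w)))
        ∂trajLaw κ t₀ v
      = ∫⁻ w, ∫⁻ p, ENNReal.ofReal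
          (returnProb b m (if p.1 = p.2 then runLength n (history n w) + 1 else 0))
            ∂κ (t₀ + n + 1) (past v n (history n w)) ∂trajLaw κ t₀ v := by
        simp only [runLength_succ]
        exact lintegral_trajLaw_succ κ t₀ v n (F := fun h => ENNReal.ofReal
          (returnProb b m (if h.2.1 = h.2.2 then runLength n h.1 + 1 else 0))) .of_discrete
    _ ≤ ∫⁻ w, (ENNReal.ofReal (returnProb b (m + 1) (runLength n (history n w))) +
          ENNReal.ofReal (returnProb b m 0 * δ (t₀ + n + 1))) ∂trajLaw κ t₀ v :=
        lintegral_mono fun w => lintegral_returnProb_ite_le hb hanti _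
          (A := {p : E × E | p.1 = p.2}) .of_discrete (hδ _)
          (hκ _ _ _ fun _ => past_fst_eq_past_snd_of_lt_runLength v) m
    _ = _ := by
        rw [lintegral_add_right _ measurable_const, lintegral_const, measure_univ, mul_one]

theorem lintegral_returnProb_runLength_le (n m : ℕ) :
    ∫⁻ w, ENNReal.ofReal (returnProb b m (runLength n (history n w))) ∂trajLaw κ t₀ v ≤
      ENNReal.ofReal (returnProb b (n + m) 0 +
        ∑ ℓ ∈ Finset.range n, returnProb b (m + ℓ) 0 * δ (n + t₀ - ℓ)) := by
  induction n generalizing m with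
  | zero => simp [runLength]
  | succ n ih =>
    have h_term (k : ℕ) (t : ℤ) : 0 ≤ returnProb b k 0 * δ t :=
      mul_nonneg (returnProb_nonneg hb k 0) (hδ t)
    calc _ ≤ _ := lintegral_returnProb_runLength_succ_le hb hanti hδ hκ t₀ v n m
      _ ≤ ENNReal.ofReal (returnProb b (n + (m + 1)) 0 +
            ∑ ℓ ∈ Finset.range n, returnProb b (m + 1 + ℓ) 0 * δ (n + t₀ - ℓ)) +
          ENNReal.ofReal (returnProb b m 0 * δ (t₀ + n + 1)) := by
        gcongr
        exact ih (m + 1)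
      _ = _ := by
        rw [← ENNReal.ofReal_add (add_nonneg (returnProb_nonneg hb _ _)
          (Finset.sum_nonneg fun ℓ _ => h_term _ _)) (h_term _ _), Finset.sum_range_succ']
        have h_end : n + (m + 1) = n + 1 + m := by ring
        have h_index (ℓ : ℕ) : m + 1 + ℓ = m + (ℓ + 1) := by ring
        have h_time (ℓ : ℕ) : ((n + 1 : ℕ) : ℤ) + t₀ - (ℓ + 1 : ℕ) = n + t₀ - ℓ := by
          push_cast
          ring
        have h_last : ((n + 1 : ℕ) : ℤ) + t₀ - (0 : ℕ) = t₀ + n + 1 := by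
          push_cast
          ring
        simp only [h_end, h_index, h_time, h_last, add_zero, add_assoc (returnProb b _ 0)]

theorem pathLaw_ne_le (t : ℕ+) :
    (pathLaw κ t₀ v).real {w | (w t).1 ≠ (w t).2} ≤
      starCoeff b hb (t - 1) + δ (t + t₀) +
        ∑ ℓ ∈ Finset.range (t - 1), starCoeff b hb ℓ * δ (t + t₀ - ℓ - 1) := by
  obtain ⟨n, rfl⟩ : ∃ n : ℕ, t = n.succPNat := ⟨t.natPred, (PNat.succPNat_natPred t).symm⟩
  have h_set : MeasurableSet {w : ℕ+ → E × E | (w n.succPNat).1 ≠ (w n.succPNat).2} :=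
    measurable_pi_apply (X := fun _ : ℕ+ => E × E) n.succPNat
      (.of_discrete (s := {p : E × E | p.1 ≠ p.2}))
  have h_law : pathLaw κ t₀ v {w | (w n.succPNat).1 ≠ (w n.succPNat).2} =
      ∫⁻ w, ENNReal.ofReal (returnProb b 0 (runLength (n + 1) (history (n + 1) w)))
        ∂trajLaw κ t₀ v := by
    have h_traj : MeasurableSet {w : ℕ → E × E | (w (n + 1)).1 ≠ (w (n + 1)).2} :=
      measurable_pi_apply (X := fun _ : ℕ => E × E) (n + 1)
        (.of_discrete (s := {p : E × E | p.1 ≠ p.2}))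
    rw [pathLaw_apply κ t₀ v h_set]
    refine (lintegral_indicator_one h_traj).symm.trans (lintegral_congr fun w => ?_)
    by_cases hw : (w (n + 1)).1 = (w (n + 1)).2 <;>
      simp [returnProb, runLength_succ_eq_zero_iff, hw]
  have h_bound := ENNReal.toReal_le_of_le_ofReal
    (add_nonneg (returnProb_nonneg hb _ _) (Finset.sum_nonneg fun ℓ _ =>
      mul_nonneg (returnProb_nonneg hb _ _) (hδ _)))
    (lintegral_returnProb_runLength_le hb hanti hδ hκ t₀ v (n + 1) 0)
  rw [← h_law, ← measureReal_def, Finset.sum_range_succ', ← add_assoc, add_right_comm] at h_bound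
  refine h_bound.trans (add_le_add (add_le_add (returnProb_le_starCoeff hb hanti n) ?_)
    (Finset.sum_le_sum fun ℓ _ => ?_))
  · simp [returnProb]
  · rw [zero_add, Nat.cast_succ ℓ, ← sub_sub]
    exact mul_le_mul_of_nonneg_right (returnProb_le_starCoeff hb hanti ℓ) (hδ _)

end Disagreement

section CoupledLaw

variable {E : Type*} [Fintype E] [MeasurableSpace E] [DiscreteMeasurableSpace E]

theorem dTV_le_iSup (κ η : Kernel (ℕ → E) E) [IsMarkovKernel κ] [IsMarkovKernel η] (s : ℕ → E) :
    dTV (κ s) (η s) ≤ ⨆ s, dTV (κ s) (η s) :=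
  le_ciSup (f := fun s => dTV (κ s) (η s))
    ⟨1, Set.forall_mem_range.2 fun s => (dTV_mem_Icc (κ s) (η s)).2⟩ s

theorem coupledKernel_ne_le (κ η : Kernel (ℕ → E) E) [IsMarkovKernel κ] [IsMarkovKernel η]
    (v : ℕ → E × E) :
    coupledKernel κ η v {p | p.1 ≠ p.2} ≤ ENNReal.ofReal
      (dTV (κ fun i => (v i).1) (κ fun i => (v i).2) + ⨆ s, dTV (κ s) (η s)) := by
  rw [coupledKernel_apply]
  refine (maxCoupling_ne_le _ _).trans (ENNReal.ofReal_le_ofReal ?_)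
  exact (dTV_triangle _ (κ fun i => (v i).2) _).trans (add_le_add le_rfl (dTV_le_iSup κ η _))

/-- The coupling of two path laws in which each step is taken by the maximal coupling of the two
conditional laws given the pair of pasts. -/
def coupledLaw (q qbar : ℤ → Kernel (ℕ → E) E) [∀ t, IsMarkovKernel (q t)]
    [∀ t, IsMarkovKernel (qbar t)] (t₀ : ℤ) (z zbar : ℕ → E) : Measure ((ℕ+ → E) × (ℕ+ → E)) :=
  (pathLaw (fun t => coupledKernel (q t) (qbar t)) t₀ fun j => (z j, zbar j)).map
    (MeasurableEquiv.arrowProdEquivProdArrow E E ℕ+)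

variable (q qbar : ℤ → Kernel (ℕ → E) E) [∀ t, IsMarkovKernel (q t)] [∀ t, IsMarkovKernel (qbar t)]
  (t₀ : ℤ) (z zbar : ℕ → E)

instance : IsProbabilityMeasure (coupledLaw q qbar t₀ z zbar) :=
  Measure.isProbabilityMeasure_map (MeasurableEquiv.measurable _).aemeasurable

theorem fst_coupledLaw : (coupledLaw q qbar t₀ z zbar).fst = pathLaw q t₀ z := by
  rw [coupledLaw, Measure.fst, Measure.map_map measurable_fst (MeasurableEquiv.measurable _)]
  exact map_pathLaw (f := Prod.fst) (fun t => coupledKernel (q t) (qbar t)) t₀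
    (fun j => (z j, zbar j)) q (fun t v => fst_maxCoupling _ _) measurable_fst

theorem snd_coupledLaw : (coupledLaw q qbar t₀ z zbar).snd = pathLaw qbar t₀ zbar := by
  rw [coupledLaw, Measure.snd, Measure.map_map measurable_snd (MeasurableEquiv.measurable _)]
  exact map_pathLaw (f := Prod.snd) (fun t => coupledKernel (q t) (qbar t)) t₀
    (fun j => (z j, zbar j)) qbar (fun t v => snd_maxCoupling _ _) measurable_snd

theorem coupledLaw_ne_le {b : ℕ → ℝ} (hb : ∀ i, b i ∈ Set.Icc (0 : ℝ) 1) (hanti : Antitone b)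
    (hq : ∀ t m y y', (∀ i < m, y i = y' i) → dTV (q t y) (q t y') ≤ b m) (t : ℕ+) :
    (coupledLaw q qbar t₀ z zbar).real {p | p.1 t ≠ p.2 t} ≤
      starCoeff b hb (t - 1) + (⨆ s, dTV (q (t + t₀) s) (qbar (t + t₀) s)) +
        ∑ ℓ ∈ Finset.range (t - 1), starCoeff b hb ℓ *
          ⨆ s, dTV (q (t + t₀ - ℓ - 1) s) (qbar (t + t₀ - ℓ - 1) s) := by
  rw [coupledLaw, measureReal_def, MeasurableEquiv.map_apply, ← measureReal_def]
  refine pathLaw_ne_le hb hanti (δ := fun t => ⨆ s, dTV (q t s) (qbar t s))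
    (fun t => Real.iSup_nonneg fun _ => dTV_nonneg _ _) (fun t v m hv => ?_) t₀ _ t
  refine (coupledKernel_ne_le (q t) (qbar t) v).trans (ENNReal.ofReal_le_ofReal ?_)
  exact add_le_add (hq t m _ _ hv) le_rfl

omit [∀ t, IsMarkovKernel (q t)] [∀ t, IsMarkovKernel (qbar t)] in
theorem measurable_coupledLaw {Ω : Type*} [MeasurableSpace Ω] {q qbar : Ω → ℤ → Kernel (ℕ → E) E}
    [∀ ω t, IsMarkovKernel (q ω t)] [∀ ω t, IsMarkovKernel (qbar ω t)]
    (hq : ∀ t, Measurable fun p : Ω × (ℕ → E) => q p.1 t p.2)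
    (hqbar : ∀ t, Measurable fun p : Ω × (ℕ → E) => qbar p.1 t p.2) {z zbar : Ω → ℕ → E}
    (hz : Measurable z) (hzbar : Measurable zbar) (t₀ : ℤ) :
    Measurable fun ω => coupledLaw (q ω) (qbar ω) t₀ (z ω) (zbar ω) := by
  refine (Measure.measurable_map _ (MeasurableEquiv.measurable _)).comp
    (measurable_pathLaw (fun t => ?_) (by fun_prop) t₀)
  have h_fst : Measurable fun p : Ω × (ℕ → E × E) => (p.1, fun i => (p.2 i).1) := by fun_prop
  have h_snd : Measurable fun p : Ω × (ℕ → E × E) => (p.1, fun i => (p.2 i).2) := by fun_prop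
  exact measurable_maxCoupling ((hq t).comp h_fst) ((hqbar t).comp h_snd)

end CoupledLaw

section ContCoeff

variable {E 𝒳 : Type*} [Fintype E] [MeasurableSpace E] [DiscreteMeasurableSpace E]
  (q : ℤ → 𝒳 → Kernel (ℕ → E) E) [∀ t x, IsMarkovKernel (q t x)]

theorem dTV_le_contCoeff (t : ℤ) (x : 𝒳) {m : ℕ} {y y' : ℕ → E} (h : ∀ i < m, y i = y' i) :
    dTV (q t x y) (q t x y') ≤ contCoeff q m := by
  refine le_csSup ⟨1, ?_⟩ ⟨t, x, y, y', h, rfl⟩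
  rintro r ⟨t, x, y, y', -, rfl⟩
  exact (dTV_mem_Icc _ _).2

theorem contCoeff_antitone : Antitone (contCoeff q) := by
  intro m n hmn
  refine Real.sSup_le ?_ (contCoeff_mem_Icc q m).1
  rintro r ⟨t, x, y, y', h, rfl⟩
  exact dTV_le_contCoeff q t x fun i hi => h i (hi.trans_le hmn)

end ContCoeff

end CompleteConnections

end

open CompleteConnections in
theorem lemma1_general {E 𝒳 : Type*}
    [Fintype E] [MeasurableSpace E] [DiscreteMeasurableSpace E] [MeasurableSpace 𝒳]
    (q qbar : ℤ → 𝒳 → Kernel (ℕ → E) E)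
    [∀ t x, IsMarkovKernel (q t x)] [∀ t x, IsMarkovKernel (qbar t x)]
    (hq_meas : ∀ t : ℤ, Measurable fun p : E × (ℕ → E) × 𝒳 => q t p.2.2 p.2.1 {p.1})
    (hqbar_meas : ∀ t : ℤ, Measurable fun p : E × (ℕ → E) × 𝒳 => qbar t p.2.2 p.2.1 {p.1})
    (t₀ : ℤ) :
    ∃ Q : 𝒳 → (ℕ → E) → (ℕ → E) → Measure ((ℕ+ → E) × (ℕ+ → E)),
      (∀ x z zbar, IsProbabilityMeasure (Q x z zbar)) ∧
      (∀ x z zbar,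
        (∀ A : Set (ℕ+ → E), MeasurableSet A →
          Q x z zbar (A ×ˢ Set.univ) = pathLaw (fun t => q t x) t₀ z A) ∧
        (∀ B : Set (ℕ+ → E), MeasurableSet B →
          Q x z zbar (Set.univ ×ˢ B) = pathLaw (fun t => qbar t x) t₀ zbar B)) ∧
      (∀ x z zbar, ∀ t : ℕ, ∀ ht : 1 ≤ t,
        (Q x z zbar).real {p | p.1 ⟨t, ht⟩ ≠ p.2 ⟨t, ht⟩} ≤
          bStar q (t - 1)
          + (⨆ s : ℕ → E, dTV (q (t + t₀) x s) (qbar (t + t₀) x s))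
          + ∑ ℓ ∈ Finset.range (t - 1), bStar q ℓ *
              ⨆ s : ℕ → E, dTV (q (t + t₀ - ℓ - 1) x s) (qbar (t + t₀ - ℓ - 1) x s)) ∧
      (∀ C : Set ((ℕ+ → E) × (ℕ+ → E)), MeasurableSet C →
        Measurable fun p : 𝒳 × (ℕ → E) × (ℕ → E) => Q p.1 p.2.1 p.2.2 C) := by
  refine ⟨fun x z zbar => coupledLaw (fun t => q t x) (fun t => qbar t x) t₀ z zbar,
    fun x z zbar => inferInstance, fun x z zbar => ⟨fun A hA => ?_, fun B hB => ?_⟩,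
    fun x z zbar t ht => ?_, fun C hC => ?_⟩
  · rw [Set.prod_univ, ← Measure.fst_apply hA, fst_coupledLaw]
  · rw [Set.univ_prod, ← Measure.snd_apply hB, snd_coupledLaw]
  · exact coupledLaw_ne_le _ _ t₀ z zbar (contCoeff_mem_Icc q) (contCoeff_antitone q)
      (fun t m y y' h => dTV_le_contCoeff q t x h) ⟨t, ht⟩
  · have h_param : Measurable fun p : (𝒳 × (ℕ → E) × (ℕ → E)) × (ℕ → E) => (p.1.1, p.2) := by
      fun_prop
    have h_coupled := measurable_coupledLaw
      (q := fun (p : 𝒳 × (ℕ → E) × (ℕ → E)) t => q t p.1) (qbar := fun p t => qbar t p.1)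
      (fun t => (measurable_kernel_uncurry_of_singleton (hq_meas t)).comp h_param)
      (fun t => (measurable_kernel_uncurry_of_singleton (hqbar_meas t)).comp h_param)
      (measurable_fst.comp measurable_snd) (measurable_snd.comp measurable_snd) t₀
    exact (Measure.measurable_coe hC).comp h_coupled

open CompleteConnections in
theorem lemma1 {E 𝒳 : Type*}
    [Fintype E] [MeasurableSpace E] [DiscreteMeasurableSpace E]
    [TopologicalSpace 𝒳] [PolishSpace 𝒳] [MeasurableSpace 𝒳] [BorelSpace 𝒳]
    (q qbar : ℤ → 𝒳 → Kernel (ℕ → E) E)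
    [∀ t x, IsMarkovKernel (q t x)] [∀ t x, IsMarkovKernel (qbar t x)]
    (hq_meas : ∀ t : ℤ, Measurable fun p : E × (ℕ → E) × 𝒳 => q t p.2.2 p.2.1 {p.1})
    (hqbar_meas : ∀ t : ℤ, Measurable fun p : E × (ℕ → E) × 𝒳 => qbar t p.2.2 p.2.1 {p.1})
    (hq_pos : ∀ (t : ℤ) (x : 𝒳) (z : ℕ → E) (y : E), 0 < q t x z {y})
    (hqbar_pos : ∀ (t : ℤ) (x : 𝒳) (z : ℕ → E) (y : E), 0 < qbar t x z {y})
    (hb_zero : contCoeff q 0 < 1)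
    (hb_lim : Tendsto (contCoeff q) atTop (𝓝 0))
    (t₀ : ℤ) :
    ∃ Q : 𝒳 → (ℕ → E) → (ℕ → E) → Measure ((ℕ+ → E) × (ℕ+ → E)),
      (∀ x z zbar, IsProbabilityMeasure (Q x z zbar)) ∧
      (∀ x z zbar,
        (∀ A : Set (ℕ+ → E), MeasurableSet A →
          Q x z zbar (A ×ˢ Set.univ) = pathLaw (fun t => q t x) t₀ z A) ∧
        (∀ B : Set (ℕ+ → E), MeasurableSet B →
          Q x z zbar (Set.univ ×ˢ B) = pathLaw (fun t => qbar t x) t₀ zbar B)) ∧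
      (∀ x z zbar, ∀ t : ℕ, ∀ ht : 1 ≤ t,
        (Q x z zbar).real {p | p.1 ⟨t, ht⟩ ≠ p.2 ⟨t, ht⟩} ≤
          bStar q (t - 1)
          + (⨆ s : ℕ → E, dTV (q (t + t₀) x s) (qbar (t + t₀) x s))
          + ∑ ℓ ∈ Finset.range (t - 1), bStar q ℓ *
              ⨆ s : ℕ → E, dTV (q (t + t₀ - ℓ - 1) x s) (qbar (t + t₀ - ℓ - 1) x s)) ∧
      (∀ C : Set ((ℕ+ → E) × (ℕ+ → E)), MeasurableSet C →
        Measurable fun p : 𝒳 × (ℕ → E) × (ℕ → E) => Q p.1 p.2.1 p.2.2 C) :=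
  lemma1_general q qbar hq_meas hqbar_meas t₀
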